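/- Binary strings and natural numbers are identified by the standard length-lexicographic bijection. Let $U$ be a universal and additively optimal binary machine: a partial computable map $(y,p)\mapsto U(y,p)$ (input $y$, program $p$) such that every partial computable function of strings is $y\mapsto U(y,p)$ for some program $p$, and such that for every partial computable $V$ there is a constant $c$ for which $V(y,p)=x$ implies $U(y,q)=x$ for some $q$ with $|q|\le |p|+c$. Let $C(x)$ be the plain Kolmogorov complexity of $x$, i.e. the length of a shortest $p$ with $U(\epsilon,p)=x$; $C(n)$ is the complexity of the string identified with the number $n$. A real $\alpha$ is left c.e. if it is the limit of a computable nondecreasing sequence of rationals; write $\alpha_n$ for the string of its first $n$ binary digits after the binary point. **Theorem.** There is a computable function $D:\mathbb{N}\to\mathbb{N}$ (depending only on $U$) such that the following holds for every left c.e. real $\alpha$ whose binary digit sequence is not computable. There is a program $P$ of $U$ that enumerates a nondecreasing sequence of rationals converging to $\alpha$ (that is, on input $s$ it outputs the $s$-th term of the sequence, in a fixed coding of the rationals by numbers), and for every such program $P$, with $d=D(|P|)$, there is a partial function $C^*:\subseteq\mathbb{N}\to\mathbb{N}$, Turing computable from the digit sequence of $\alpha$, such that: 1. $C^*(n)$ is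 defined and $C^*(n)=C(n)$ at every $n$ with $C(\alpha_n)>C(n)+d$; 2. there are infinitely many $n$ with $C(\alpha_n)>C(n)+d$; 3. consequently $C^*(n)=C(n)$ for infinitely many $n$. -/

import Mathlib

/-- A machine: `U y p` is the output (if any) of program `p` on input `y`. -/
abbrev Machine := List Bool → List Bool →. List Bool

/-- `C_U(x | y)`: the length of a shortest program that outputs `x` on input `y`. (For the
additively optimal machines below the set is never empty, so the infimum is attained.) -/
noncomputable def condComplexity (U : Machine) (x y : List Bool) : ℕ :=
  sInf {l | ∃ p : List Bool, p.length = l ∧ x ∈ U y p}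

/-- `C_U(x) = C_U(x | ε)`. -/
noncomputable def complexity (U : Machine) (x : List Bool) : ℕ :=
  condComplexity U x []

/-- `U` is a universal and additively optimal machine: it is partial computable, every partial
computable function of strings is computed by one of its programs, and it gives shortest
descriptions up to an additive constant among all partial computable machines. -/
structure IsUniversalOptimal (U : Machine) : Prop where
  partrec : Partrec₂ U
  universal : ∀ f : List Bool →. List Bool, Partrec f → ∃ p, ∀ y, U y p = f y
  optimal : ∀ V : Machine, Partrec₂ V →
    ∃ c : ℕ, ∀ x y p, x ∈ V y p → ∃ q, x ∈ U y q ∧ q.length ≤ p.length + c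

/-- The standard identification of natural numbers with binary strings in length-lexicographic
order: `0 ↦ ε`, `1 ↦ 0`, `2 ↦ 1`, `3 ↦ 00`, ...; the string of `n` is the binary expansion of
`n + 1` without its leading `1`. -/
def natToStr (n : ℕ) : List Bool := (n + 1).bits.dropLast.reverse

/-- The inverse of `natToStr`. -/
def strToNat (x : List Bool) : ℕ := x.foldl (fun m b => 2 * m + b.toNat) 1 - 1

theorem natToStr_zero : natToStr 0 = [] := by simp [natToStr]

theorem natToStr_bit (n : ℕ) (b : Bool) : natToStr (2 * n + 1 + b.toNat) = natToStr n ++ [b] := by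
  have h : 2 * n + 1 + b.toNat + 1 = Nat.bit b (n+1) := by cases b <;> simp [Nat.bit] <;> ring
  have hne : (n+1).bits ≠ [] := by
    intro h'; have := congrArg List.length h'; rw [Nat.size_eq_bits_len] at this; simp [Nat.size_eq_zero] at this
  rw [natToStr, h, Nat.bits_append_bit _ _ (by simp), List.dropLast_cons_of_ne_nil hne]
  simp [natToStr]

theorem strToNat_append (x : List Bool) (b : Bool) : strToNat (x ++ [b]) = 2 * strToNat x + 1 + b.toNat := by
  have : ∀ (x : List Bool) m, 1 ≤ m → 1 ≤ x.foldl (fun m b => 2 * m + b.toNat) m := by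
    intro x; induction x with
    | nil => intro m hm; simpa using hm
    | cons a l ih => intro m hm; rw [List.foldl_cons]; apply ih; omega
  have := this x 1 le_rfl
  simp only [strToNat, List.foldl_append, List.foldl_cons, List.foldl_nil]; omega

theorem natToStr_strToNat (x : List Bool) : natToStr (strToNat x) = x := by
  induction x using List.reverseRecOn with
  | nil => simp [strToNat, natToStr_zero]
  | append_singleton l b ih => rw [strToNat_append, natToStr_bit, ih]

theorem strToNat_natToStr (n : ℕ) : strToNat (natToStr n) = n := by
  induction n using Nat.strong_induction_on with
  | _ n ih =>
    rcases Nat.eq_zero_or_pos n with rfl | hn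
    · simp [natToStr_zero, strToNat]
    · obtain ⟨m, b, rfl⟩ : ∃ m, ∃ b : Bool, n = 2 * m + 1 + b.toNat := by
        rcases Nat.even_or_odd' n with ⟨k, h | h⟩
        · exact ⟨k-1, true, by simp; omega⟩
        · exact ⟨k, false, by simp; omega⟩
      rw [natToStr_bit, strToNat_append, ih m (by omega)]

/-- `C_U(n)` for a natural number `n`. -/
noncomputable def natComplexity (U : Machine) (n : ℕ) : ℕ := complexity U (natToStr n)

/-- A numbering of the rationals: the triple `(a, b, c)` of naturals stands for
`(a - b) / (c + 1)`. -/
def natToRat (m : ℕ) : ℚ :=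
  ((m.unpair.1.unpair.1 : ℚ) - (m.unpair.1.unpair.2 : ℚ)) / ((m.unpair.2 : ℚ) + 1)

theorem natToRat_surjective : Function.Surjective natToRat := by
  intro r
  refine ⟨Nat.pair (Nat.pair r.num.toNat (-r.num).toNat) (r.den - 1), ?_⟩
  simp only [natToRat, Nat.unpair_pair]
  have h1 : ((r.num.toNat : ℚ) - ((-r.num).toNat : ℚ)) = r.num := by
    have : ((r.num.toNat : ℤ) - ((-r.num).toNat : ℤ)) = r.num := by omega
    exact_mod_cast this
  have h2 : (((r.den - 1 : ℕ) : ℚ) + 1) = r.den := by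
    have := r.den_pos
    have : r.den - 1 + 1 = r.den := by omega
    exact_mod_cast this
  rw [h1, h2, Rat.num_div_den]

/-- A real is left c.e. if it is the limit of a computable nondecreasing sequence of rationals. -/
def IsLeftCE (α : ℝ) : Prop :=
  ∃ q : ℕ → ℕ, Computable q ∧ Monotone (fun s => natToRat (q s)) ∧
    Filter.Tendsto (fun s => (natToRat (q s) : ℝ)) Filter.atTop (nhds α)

/-- `P` is a program for the machine `U` that enumerates a nondecreasing sequence of rationals
converging to `α`: on input (the string of) `s` it outputs (the string of a code of) the `s`-th
term. -/
def Enumerates (U : Machine) (P : List Bool) (α : ℝ) : Prop :=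
  ∃ q : ℕ → ℕ, (∀ s, natToStr (q s) ∈ U (natToStr s) P) ∧
    Monotone (fun s => natToRat (q s)) ∧
    Filter.Tendsto (fun s => (natToRat (q s) : ℝ)) Filter.atTop (nhds α)

/-- The binary digits of `α` after the binary point: `binDigit α k` is the digit of weight
`2 ^ (-(k + 1))`. -/
noncomputable def binDigit (α : ℝ) (k : ℕ) : Bool := decide (⌊(2 : ℝ) ^ (k + 1) * α⌋ % 2 = 1)

/-- The initial segment `α_n`, the first `n` binary digits of `α`. -/
noncomputable def initSeg (α : ℝ) (n : ℕ) : List Bool := (List.range n).map (binDigit α)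

/-- The digit sequence of `α` as a (total) oracle. -/
noncomputable def digitOracle (α : ℝ) : ℕ →. ℕ := fun k => Part.some (binDigit α k).toNat

/-! Given `α_n`, find the first stage of the enumeration, from some `s₀` on, with the right `n`
digits; run all programs for that many steps and take the least one that prints `n`. This fails to
give `C(n)` only if a shortest program `p` of `n` is slower than that stage. Then the running time
of `p` is a stage at which the `n` digits are right, so `P` and `p` together describe `α_n`, and
`C(α_n) ≤ C(n) + d` (`mem_digitMachine`). The shift `s₀` enters `C*` but not this description, so
`d` depends on `|P|` only.

If the gap exceeded `d` only finitely often, `α` would be computable. Lengths in `[2 ^ i, 2 ^ (i +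
1))` would then have initial segments with programs numbered below `2 ^ (i + e)`, for a constant
`e`. While the approximation is wrong at digit length `2 ^ i`, the `2 ^ i` programs of the true
segments are still uncounted (`exists_hitCount_ge`). As at most `2 ^ e * 2 ^ i` programs can be
counted, some multiple `r` of `2 ^ i` is reached for infinitely many `i`, but `r + 1` only for
finitely many; reaching `r` certifies correct digits for large `i` (`computable_of_short_programs`).
-/

/-! ### Computability and size bounds of the string numbering. -/

theorem strToNat_injective : Function.Injective strToNat :=
  Function.LeftInverse.injective natToStr_strToNat

theorem primrec_strToNat : Primrec strToNat := by
  have h : Primrec fun x : List Bool => x.foldl (fun m b => 2 * m + b.toNat) 1 :=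
    Primrec.list_foldl (h := fun _ (p : ℕ × Bool) => 2 * p.1 + p.2.toNat) Primrec.id (Primrec.const 1)
      (Primrec.nat_add.comp
        (Primrec.nat_double.comp (Primrec.fst.comp Primrec.snd))
        ((Primrec.dom_bool Bool.toNat).comp (Primrec.snd.comp Primrec.snd)))
  exact Primrec.nat_sub.comp h (Primrec.const 1)

theorem computable_natToStr : Computable natToStr := by
  let f : ℕ → ℕ → Option (List Bool) := fun n m =>
    (Encodable.decode (α := List Bool) m).bind fun x => if strToNat x = n then some x else none
  have hf : Computable₂ f := by
    refine Primrec.to_comp (Primrec.option_bind (Primrec.decode.comp Primrec.snd) ?_)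
    exact Primrec.ite
      (Primrec.eq.comp (primrec_strToNat.comp Primrec.snd) (Primrec.fst.comp Primrec.fst))
      (Primrec.option_some.comp Primrec.snd) (Primrec.const none)
  refine (Partrec.rfindOpt hf).of_eq_tot fun n => ?_
  have hd : (Nat.rfindOpt (f n)).Dom := by
    rw [Nat.rfindOpt_dom]
    exact ⟨Encodable.encode (natToStr n), natToStr n, by simp [f, strToNat_natToStr]⟩
  obtain ⟨x, hx⟩ := Part.dom_iff_mem.1 hd
  obtain ⟨m, hm⟩ := Nat.rfindOpt_spec hx
  simp only [f, Option.mem_def, Option.bind_eq_some_iff, Option.ite_none_right_eq_some,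
    Option.some.injEq] at hm
  obtain ⟨y, -, hy, rfl⟩ := hm
  rwa [← hy, natToStr_strToNat, hy]

theorem pow_length_le_strToNat (x : List Bool) : 2 ^ x.length ≤ strToNat x + 1 := by
  induction x using List.reverseRecOn with
  | nil => simp
  | append_singleton l b ih =>
    rw [strToNat_append, List.length_append, List.length_singleton, pow_succ]; omega

theorem strToNat_lt_pow_length (x : List Bool) : strToNat x + 1 < 2 ^ (x.length + 1) := by
  induction x using List.reverseRecOn with
  | nil => simp [strToNat]
  | append_singleton l b ih =>
    rw [strToNat_append, List.length_append, List.length_singleton, pow_succ]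
    have := Bool.toNat_le b
    omega

theorem length_natToStr_mono {k m : ℕ} (h : k ≤ m) :
    (natToStr k).length ≤ (natToStr m).length := by
  have h1 := pow_length_le_strToNat (natToStr k)
  have h2 := strToNat_lt_pow_length (natToStr m)
  rw [strToNat_natToStr] at h1 h2
  have : 2 ^ (natToStr k).length < 2 ^ ((natToStr m).length + 1) := by omega
  have := (Nat.pow_lt_pow_iff_right (by norm_num : 1 < 2)).1 this
  omega

theorem computable_sum_range {α : Type*} [Primcodable α] {g : α → ℕ} {f : α → ℕ → ℕ}
    (hg : Computable g) (hf : Computable₂ f) :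
    Computable fun a => ∑ k ∈ Finset.range (g a), f a k := by
  refine (Computable.nat_rec (h := fun a p => p.2 + f a p.1) hg (Computable.const 0) ?_).of_eq
    fun a => ?_
  · exact Primrec.nat_add.to_comp.comp (Computable.snd.comp Computable.snd)
      (hf.comp Computable.fst (Computable.fst.comp Computable.snd))
  · induction g a with
    | zero => rfl
    | succ n ih => rw [Finset.sum_range_succ, ← ih]

theorem primrec_pow : Primrec₂ ((· ^ ·) : ℕ → ℕ → ℕ) :=
  Primrec₂.unpaired'.1 Nat.Primrec.pow

/-! ### Reading initial segments from an oracle. -/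

/-- A partial computable function of a number and of an initial segment of a bit sequence is
recursive in that sequence. -/
theorem recursiveIn_of_initial_segment {b : ℕ → Bool} {O : ℕ →. ℕ}
    (hO : ∀ k, O k = Part.some (b k).toNat) {f : ℕ → ℕ →. ℕ} (hf : Partrec₂ f) :
    TuringReducible (fun n => f n (strToNat ((List.range n).map b))) O := by
  refine RecursiveIn.iff_nat.2 ?_
  have hO' : Nat.RecursiveIn {O} O := .oracle _ rfl
  have hid : Nat.RecursiveIn {O} (fun n => Part.some n) := Nat.Primrec.id.recursiveIn
  -- Appending a bit sends the number `m` of a string to `2 * m + 1 + bit`; primitive recursion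
  -- iterates this with one query per digit.
  have hstep : Nat.RecursiveIn {O} (fun m : ℕ =>
      (Part.some (2 * m.unpair.1 + 1 + m.unpair.2) : Part ℕ)) := by
    refine Nat.Primrec.recursiveIn (f := fun m => 2 * m.unpair.1 + 1 + m.unpair.2)
      (Primrec.nat_iff.1 ?_)
    exact Primrec.nat_add.comp (Primrec.nat_double_succ.comp (Primrec.fst.comp Primrec.unpair))
      (Primrec.snd.comp Primrec.unpair)
  have hfst : Nat.RecursiveIn {O} (fun m : ℕ => (Part.some m.unpair.2.unpair.1 : Part ℕ)) :=
    Nat.Primrec.recursiveIn (f := fun m => m.unpair.2.unpair.1) (Primrec.nat_iff.1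
      (Primrec.fst.comp (Primrec.unpair.comp (Primrec.snd.comp Primrec.unpair))))
  have hsnd : Nat.RecursiveIn {O} (fun m : ℕ => (Part.some m.unpair.2.unpair.2 : Part ℕ)) :=
    Nat.Primrec.recursiveIn (f := fun m => m.unpair.2.unpair.2) (Primrec.nat_iff.1
      (Primrec.snd.comp (Primrec.unpair.comp (Primrec.snd.comp Primrec.unpair))))
  have hseg : Nat.RecursiveIn {O} (fun n : ℕ =>
      (Part.some (strToNat ((List.range n).map b)) : Part ℕ)) := by
    have h := Nat.RecursiveIn.comp
      (Nat.RecursiveIn.prec .zero (hstep.comp (hsnd.pair (hO'.comp hfst))))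
      (Nat.RecursiveIn.pair .zero hid)
    refine h.of_eq fun n => ?_
    have h0 : (0 : Part ℕ) = Part.some 0 := rfl
    simp only [h0, Seq.seq, Part.bind_eq_bind, Part.map_eq_map, Part.map_some, Part.bind_some,
      Nat.unpair_pair]
    induction n with
    | zero => rfl
    | succ n ih =>
      have hb : (Part.some n >>= O) = Part.some (b n).toNat := (Part.bind_some n O).trans (hO n)
      simp only [ih, hb, Part.map_some, Part.bind_some, Nat.unpair_pair, List.range_succ,
        List.map_append, List.map_singleton, strToNat_append]
  have hf' : Nat.RecursiveIn {O} (Nat.unpaired f) :=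
    (Partrec₂.unpaired'.2 hf).recursiveIn
  refine (hf'.comp (hid.pair hseg)).of_eq fun n => ?_
  simp [Seq.seq, Nat.unpaired]

/-! ### Binary digits, floors and rational approximations. -/

theorem floor_two_pow_succ (x : ℝ) (n : ℕ) :
    ⌊(2 : ℝ) ^ (n + 1) * x⌋ = 2 * ⌊(2 : ℝ) ^ n * x⌋ + (binDigit x n).toNat := by
  have h : ⌊(2 : ℝ) ^ n * x⌋ = ⌊(2 : ℝ) ^ (n + 1) * x⌋ / 2 := by
    have := Int.floor_div_natCast ((2 : ℝ) ^ (n + 1) * x) 2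
    rw [show (2 : ℤ) = ((2 : ℕ) : ℤ) from rfl, ← this]
    congr 1
    rw [pow_succ]; push_cast; ring
  rw [h, binDigit]
  by_cases h2 : ⌊(2 : ℝ) ^ (n + 1) * x⌋ % 2 = 1 <;> simp [h2] <;> omega

theorem initSeg_succ (x : ℝ) (n : ℕ) : initSeg x (n + 1) = initSeg x n ++ [binDigit x n] := by
  simp [initSeg, List.range_succ]

theorem length_initSeg (x : ℝ) (n : ℕ) : (initSeg x n).length = n := by simp [initSeg]

/-- Strings of length `n` are numbered from `2 ^ n - 1` on by their binary value, and the digits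
forget the integer part. Hence, for reals with a common integer part, the numbering respects their
order. -/
theorem strToNat_initSeg (x : ℝ) (n : ℕ) :
    (strToNat (initSeg x n) : ℤ) = 2 ^ n + ⌊(2 : ℝ) ^ n * x⌋ - 2 ^ n * ⌊x⌋ - 1 := by
  induction n with
  | zero => simp [initSeg, strToNat]
  | succ n ih =>
    rw [initSeg_succ, strToNat_append, floor_two_pow_succ]
    push_cast
    rw [ih, pow_succ]
    ring

theorem take_initSeg (x : ℝ) {m n : ℕ} (h : m ≤ n) : (initSeg x n).take m = initSeg x m := by
  simp [initSeg, ← List.map_take, List.take_range, h]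

/-- The number of the string of the first `n` digits of the rational with code `m`. -/
def ratDigits (n m : ℕ) : ℕ :=
  2 ^ n + 2 ^ n * (m.unpair.1.unpair.1 + m.unpair.1.unpair.2 * m.unpair.2) / (m.unpair.2 + 1) -
    2 ^ n * ((m.unpair.1.unpair.1 + m.unpair.1.unpair.2 * m.unpair.2) / (m.unpair.2 + 1)) - 1

theorem ratDigits_eq (n m : ℕ) : ratDigits n m = strToNat (initSeg (natToRat m) n) := by
  unfold ratDigits natToRat
  generalize m.unpair.1.unpair.1 = a
  generalize m.unpair.1.unpair.2 = b
  generalize m.unpair.2 = c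
  -- Splitting off the integer `b` leaves a nonnegative fraction, whose floors are divisions of
  -- naturals.
  have hx : ((((a : ℚ) - b) / (c + 1) : ℚ) : ℝ) =
      ((a + b * c : ℕ) : ℝ) / ((c + 1 : ℕ) : ℝ) - (b : ℕ) := by
    have : (c : ℝ) + 1 ≠ 0 := by positivity
    push_cast
    field_simp
    ring
  have h1 := strToNat_initSeg ((((a : ℚ) - b) / (c + 1) : ℚ) : ℝ) n
  have h2 : ⌊((((a : ℚ) - b) / (c + 1) : ℚ) : ℝ)⌋ = ((a + b * c) / (c + 1) : ℕ) - (b : ℤ) := by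
    rw [hx, Int.floor_sub_natCast, ← Nat.floor_div_eq_div (K := ℝ), Int.natCast_floor_eq_floor]
    positivity
  have h3 : ⌊(2 : ℝ) ^ n * ((((a : ℚ) - b) / (c + 1) : ℚ) : ℝ)⌋ =
      ((2 ^ n * (a + b * c)) / (c + 1) : ℕ) - (2 ^ n * b : ℤ) := by
    have : (2 : ℝ) ^ n * (((a + b * c : ℕ) : ℝ) / ((c + 1 : ℕ) : ℝ) - (b : ℕ)) =
        ((2 ^ n * (a + b * c) : ℕ) : ℝ) / ((c + 1 : ℕ) : ℝ) - (2 ^ n * b : ℕ) := by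
      push_cast; ring
    rw [hx, this, Int.floor_sub_natCast, ← Nat.floor_div_eq_div (K := ℝ),
      Int.natCast_floor_eq_floor]
    · push_cast; rfl
    · positivity
  rw [h2, h3] at h1
  have h4 : 2 ^ n * ((a + b * c) / (c + 1)) ≤ 2 ^ n * (a + b * c) / (c + 1) :=
    Nat.mul_div_le_mul_div_assoc _ _ _
  have h5 : 1 ≤ 2 ^ n := Nat.one_le_two_pow
  have h6 : (strToNat (initSeg ((((a : ℚ) - b) / (c + 1) : ℚ) : ℝ) n) : ℤ) =
      (2 ^ n : ℕ) + (2 ^ n * (a + b * c) / (c + 1) : ℕ) -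
        (2 ^ n * ((a + b * c) / (c + 1)) : ℕ) - 1 := by
    rw [h1]; push_cast; ring
  revert h4 h5 h6
  generalize 2 ^ n * (a + b * c) / (c + 1) = u
  generalize 2 ^ n * ((a + b * c) / (c + 1)) = v
  generalize 2 ^ n = w
  omega

theorem primrec_ratDigits : Primrec₂ ratDigits := by
  have hc : Primrec fun p : ℕ × ℕ => p.2.unpair.2 :=
    Primrec.snd.comp (Primrec.unpair.comp Primrec.snd)
  have hab : Primrec fun p : ℕ × ℕ => p.2.unpair.1.unpair :=
    Primrec.unpair.comp (Primrec.fst.comp (Primrec.unpair.comp Primrec.snd))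
  have hw : Primrec fun p : ℕ × ℕ =>
      p.2.unpair.1.unpair.1 + p.2.unpair.1.unpair.2 * p.2.unpair.2 :=
    Primrec.nat_add.comp (Primrec.fst.comp hab) (Primrec.nat_mul.comp (Primrec.snd.comp hab) hc)
  have hp : Primrec fun p : ℕ × ℕ => 2 ^ p.1 := primrec_pow.comp (Primrec.const 2) Primrec.fst
  have hd := Primrec.succ.comp hc
  exact Primrec.nat_sub.comp (Primrec.nat_sub.comp
    (Primrec.nat_add.comp hp (Primrec.nat_div.comp (Primrec.nat_mul.comp hp hw) hd))
    (Primrec.nat_mul.comp hp (Primrec.nat_div.comp hw hd))) (Primrec.const 1)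

theorem binDigit_eq_decide (x : ℝ) (n : ℕ) :
    binDigit x n = decide (strToNat (initSeg x (n + 1)) % 2 = 0) := by
  rw [initSeg_succ, strToNat_append]
  cases binDigit x n <;> simp <;> omega

theorem computable_binDigit_of_initSeg {x : ℝ} (h : Computable fun n => strToNat (initSeg x n)) :
    Computable (binDigit x) := by
  have h2 : Primrec fun m : ℕ => decide (m % 2 = 0) :=
    (Primrec.eq.comp (Primrec.nat_mod.comp Primrec.id (Primrec.const 2)) (Primrec.const 0)).decide
  exact (h2.to_comp.comp (h.comp Computable.succ)).of_eq fun n => (binDigit_eq_decide x n).symm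

theorem computable_of_eventually_false {f : ℕ → Bool} {n : ℕ} (h : ∀ k, n ≤ k → f k = false) :
    Computable f := by
  refine Primrec.to_comp (((Primrec.list_getD false).comp
    (Primrec.const ((List.range n).map f)) Primrec.id).of_eq fun k => ?_)
  by_cases hk : k < n
  · simp [hk]
  · simp [hk, h k (by omega)]

/-- With the floor convention a dyadic rational has only zeros from some digit on. This excludes the
one case in which digits of approximations from below might never settle. -/
theorem computable_binDigit_of_dyadic {x : ℝ} {n : ℕ} {z : ℤ} (h : (2 : ℝ) ^ n * x = z) :
    Computable (binDigit x) := by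
  refine computable_of_eventually_false (n := n) fun k hk => ?_
  obtain ⟨j, rfl⟩ := Nat.exists_eq_add_of_le hk
  have : (2 : ℝ) ^ (n + j + 1) * x = ((2 * (2 ^ j * z) : ℤ) : ℝ) := by
    push_cast; rw [← h]; ring
  rw [binDigit, this, Int.floor_intCast]
  simp

/-- What the digit strings of the terms of a nondecreasing approximation to `α`, taken from a
suitable term on, have in common. -/
structure DigitApprox (A : ℕ → ℕ) (a : ℕ → ℕ → ℕ) : Prop where
  mono : ∀ n, Monotone (a n)
  le : ∀ n s, a n s ≤ A n
  eventually_eq : ∀ n, ∃ s, a n s = A n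
  ne_of_ne : ∀ m n s, m ≤ n → a m s ≠ A m → a n s ≠ A n

theorem DigitApprox.eq_of_le {A : ℕ → ℕ} {a : ℕ → ℕ → ℕ} (h : DigitApprox A a) {n s t : ℕ}
    (hst : s ≤ t) (hs : a n s = A n) : a n t = A n :=
  le_antisymm (h.le n t) (hs ▸ h.mono n hst)

theorem exists_digitApprox {α : ℝ} {q : ℕ → ℕ} (hmono : Monotone fun s => natToRat (q s))
    (hlim : Filter.Tendsto (fun s => (natToRat (q s) : ℝ)) Filter.atTop (nhds α))
    (hα : ¬ Computable (binDigit α)) :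
    ∃ s₀, DigitApprox (fun n => strToNat (initSeg α n)) (fun n s => ratDigits n (q (s + s₀))) := by
  have hmono' : Monotone fun s => (natToRat (q s) : ℝ) := fun s t h => by
    exact Rat.cast_le.2 (hmono h)
  have hle : ∀ s, (natToRat (q s) : ℝ) ≤ α := hmono'.ge_of_tendsto hlim
  have hev : ∀ n : ℕ, ∀ᶠ s in Filter.atTop,
      ⌊(2 : ℝ) ^ n * (natToRat (q s) : ℝ)⌋ = ⌊(2 : ℝ) ^ n * α⌋ := by
    intro n
    have hlt : (⌊(2 : ℝ) ^ n * α⌋ : ℝ) < 2 ^ n * α :=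
      lt_of_le_of_ne (Int.floor_le _) fun h => hα (computable_binDigit_of_dyadic h.symm)
    filter_upwards [(hlim.const_mul ((2 : ℝ) ^ n)).eventually (lt_mem_nhds hlt)] with s hs
    refine le_antisymm (Int.floor_mono ?_) (Int.le_floor.2 hs.le)
    exact mul_le_mul_of_nonneg_left (hle s) (by positivity)
  -- Before the integer part settles, the fractional digits can drop when the approximation passes
  -- an integer.
  obtain ⟨s₀, hs₀⟩ := Filter.eventually_atTop.1 (hev 0)
  have hfl : ∀ s, ⌊(natToRat (q (s + s₀)) : ℝ)⌋ = ⌊α⌋ := fun s => by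
    simpa using hs₀ (s + s₀) (by omega)
  refine ⟨s₀, ?_, ?_, ?_, ?_⟩
  · intro n s t hst
    have h := hmono' (show s + s₀ ≤ t + s₀ by omega)
    have h1 := strToNat_initSeg (natToRat (q (s + s₀))) n
    have h2 := strToNat_initSeg (natToRat (q (t + s₀))) n
    have h3 : ⌊(2 : ℝ) ^ n * (natToRat (q (s + s₀)) : ℝ)⌋ ≤
        ⌊(2 : ℝ) ^ n * (natToRat (q (t + s₀)) : ℝ)⌋ :=
      Int.floor_mono (mul_le_mul_of_nonneg_left h (by positivity))
    rw [hfl] at h1 h2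
    simp only [ratDigits_eq]
    omega
  · intro n s
    have h1 := strToNat_initSeg (natToRat (q (s + s₀))) n
    have h2 := strToNat_initSeg α n
    have h3 : ⌊(2 : ℝ) ^ n * (natToRat (q (s + s₀)) : ℝ)⌋ ≤ ⌊(2 : ℝ) ^ n * α⌋ :=
      Int.floor_mono (mul_le_mul_of_nonneg_left (hle _) (by positivity))
    rw [hfl] at h1
    simp only [ratDigits_eq]
    omega
  · intro n
    obtain ⟨t, ht⟩ := Filter.eventually_atTop.1 (hev n)
    refine ⟨t, ?_⟩
    have h1 := strToNat_initSeg (natToRat (q (t + s₀))) n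
    have h2 := strToNat_initSeg α n
    rw [hfl, ht _ (by omega)] at h1
    simp only [ratDigits_eq]
    omega
  · intro m n s hmn h1 h2
    simp only [ratDigits_eq] at h1 h2
    apply h1
    have h := congrArg (List.take m) (strToNat_injective h2)
    rw [take_initSeg _ hmn, take_initSeg _ hmn] at h
    rw [h]

/-! ### Counting programs on dyadic blocks of lengths. -/

open Nat.Partrec (Code)

theorem computable_evaln (c : Code) : Computable₂ fun s k : ℕ => Code.evaln s c k :=
  (Code.primrec_evaln.comp
    (Primrec.pair (Primrec.pair Primrec.fst (Primrec.const c)) Primrec.snd)).to_comp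

/-- Within `s` steps the program `k` of the machine `c` outputs a string whose length is in
`[2 ^ i, 2 ^ (i + 1))` and which is at most the string of `a` of that length at stage `s`. -/
def hitsBlock (c : Code) (a : ℕ → ℕ → ℕ) (i s k : ℕ) : Bool :=
  ((Code.evaln s c k).map fun x =>
    decide (2 ^ i ≤ (natToStr x).length) && decide ((natToStr x).length < 2 ^ (i + 1)) &&
      decide (x ≤ a (natToStr x).length s)).getD false

theorem hitsBlock_iff {c : Code} {a : ℕ → ℕ → ℕ} {i s k : ℕ} :
    hitsBlock c a i s k = true ↔ ∃ x ∈ Code.evaln s c k, 2 ^ i ≤ (natToStr x).length ∧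
      (natToStr x).length < 2 ^ (i + 1) ∧ x ≤ a (natToStr x).length s := by
  unfold hitsBlock
  cases Code.evaln s c k <;> simp [and_assoc]

theorem computable_hitsBlock (c : Code) {a : ℕ → ℕ → ℕ} (ha : Computable₂ a) :
    Computable fun p : (ℕ × ℕ) × ℕ => hitsBlock c a p.1.1 p.1.2 p.2 := by
  refine Computable.option_getD (Computable.option_map ((computable_evaln c).comp
    (Computable.snd.comp Computable.fst) Computable.snd) ?_) (Computable.const false)
  have hlen : Computable fun p : ((ℕ × ℕ) × ℕ) × ℕ => (natToStr p.2).length :=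
    Computable.list_length.comp (computable_natToStr.comp Computable.snd)
  have hi : Computable fun p : ((ℕ × ℕ) × ℕ) × ℕ => p.1.1.1 :=
    Computable.fst.comp (Computable.fst.comp Computable.fst)
  have hs : Computable fun p : ((ℕ × ℕ) × ℕ) × ℕ => p.1.1.2 :=
    Computable.snd.comp (Computable.fst.comp Computable.fst)
  have hp := primrec_pow.to_comp
  refine Primrec.and.to_comp.comp (Primrec.and.to_comp.comp ?_ ?_) ?_
  · exact Primrec.nat_le.decide.to_comp.comp (hp.comp (Computable.const 2) hi) hlen
  · exact Primrec.nat_lt.decide.to_comp.comp hlen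
      (hp.comp (Computable.const 2) (Computable.succ.comp hi))
  · exact Primrec.nat_le.decide.to_comp.comp Computable.snd (ha.comp hlen hs)

/-- The number of programs `k < 2 ^ (i + e)` that hit the block `[2 ^ i, 2 ^ (i + 1))`. -/
def hitCount (c : Code) (a : ℕ → ℕ → ℕ) (e i s : ℕ) : ℕ :=
  ∑ k ∈ Finset.range (2 ^ (i + e)), (hitsBlock c a i s k).toNat

theorem computable_hitCount (c : Code) {a : ℕ → ℕ → ℕ} (ha : Computable₂ a) (e : ℕ) :
    Computable₂ (hitCount c a e) :=
  computable_sum_range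
    (primrec_pow.to_comp.comp (Computable.const 2)
      (Primrec.nat_add.to_comp.comp Computable.fst (Computable.const e)))
    ((Primrec.dom_bool Bool.toNat).to_comp.comp (computable_hitsBlock c ha))

theorem hitCount_eq_card (c : Code) (a : ℕ → ℕ → ℕ) (e i s : ℕ) :
    hitCount c a e i s =
      ((Finset.range (2 ^ (i + e))).filter fun k => hitsBlock c a i s k = true).card := by
  rw [hitCount, Finset.card_filter]
  refine Finset.sum_congr rfl fun k _ => ?_
  cases hitsBlock c a i s k <;> simp

theorem hitCount_le (c : Code) (a : ℕ → ℕ → ℕ) (e i s : ℕ) :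
    hitCount c a e i s ≤ 2 ^ e * 2 ^ i := by
  rw [hitCount_eq_card, ← pow_add, add_comm e]
  exact (Finset.card_filter_le _ _).trans (Finset.card_range _).le

/-- If an approximation is wrong at the start of a block, then the strings of all lengths in the
block are still to be described. -/
theorem exists_hitCount_ge {c : Code} {A : ℕ → ℕ} {a : ℕ → ℕ → ℕ} (h : DigitApprox A a)
    (hlen : ∀ n, (natToStr (A n)).length = n) {e i s : ℕ}
    (hC : ∀ n, 2 ^ i ≤ n → n < 2 ^ (i + 1) → ∃ k < 2 ^ (i + e), A n ∈ c.eval k)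
    (hs : a (2 ^ i) s ≠ A (2 ^ i)) :
    ∃ t, hitCount c a e i s + 2 ^ i ≤ hitCount c a e i t := by
  have hC' : ∀ n, ∃ k, 2 ^ i ≤ n → n < 2 ^ (i + 1) → k < 2 ^ (i + e) ∧ A n ∈ c.eval k := by
    intro n
    by_cases hn : 2 ^ i ≤ n ∧ n < 2 ^ (i + 1)
    · obtain ⟨k, hk⟩ := hC n hn.1 hn.2
      exact ⟨k, fun _ _ => hk⟩
    · exact ⟨0, fun h1 h2 => absurd ⟨h1, h2⟩ hn⟩
  choose k hk using hC'
  have ht : ∀ n, ∃ t, ∀ t' ≥ t, a n t' = A n ∧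
      (2 ^ i ≤ n → n < 2 ^ (i + 1) → A n ∈ Code.evaln t' c (k n)) := by
    intro n
    obtain ⟨t₁, ht₁⟩ := h.eventually_eq n
    by_cases hn : 2 ^ i ≤ n ∧ n < 2 ^ (i + 1)
    · obtain ⟨t₂, ht₂⟩ := Code.evaln_complete.1 (hk n hn.1 hn.2).2
      exact ⟨max t₁ t₂, fun t' ht' => ⟨h.eq_of_le (le_of_max_le_left ht') ht₁,
        fun _ _ => Code.evaln_mono (le_of_max_le_right ht') ht₂⟩⟩
    · exact ⟨t₁, fun t' ht' => ⟨h.eq_of_le ht' ht₁, fun h1 h2 => absurd ⟨h1, h2⟩ hn⟩⟩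
  choose τ hτ using ht
  let T := max s ((Finset.range (2 ^ (i + 1))).sup τ)
  have hT : ∀ n, n < 2 ^ (i + 1) → τ n ≤ T := fun n hn =>
    (Finset.le_sup (f := τ) (Finset.mem_range.2 hn)).trans (le_max_right _ _)
  refine ⟨T, ?_⟩
  -- A program has one output, and the length of the string of `A n` recovers `n`.
  have hinj : Set.InjOn k (Finset.Ico (2 ^ i) (2 ^ (i + 1)) : Finset ℕ) := by
    intro m hm n hn hmn
    simp only [Finset.coe_Ico, Set.mem_Ico] at hm hn
    have h1 := (hk m hm.1 hm.2).2
    have h2 := (hk n hn.1 hn.2).2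
    rw [hmn] at h1
    rw [← hlen m, ← hlen n, Part.mem_unique h1 h2]
  have hcard : ((Finset.Ico (2 ^ i) (2 ^ (i + 1))).image k).card = 2 ^ i := by
    rw [Finset.card_image_of_injOn hinj, Nat.card_Ico, pow_succ]; omega
  rw [hitCount_eq_card, hitCount_eq_card, ← hcard, ← Finset.card_union_of_disjoint]
  · refine Finset.card_le_card (Finset.union_subset ?_ ?_)
    · intro j hj
      rw [Finset.mem_filter, hitsBlock_iff] at hj ⊢
      obtain ⟨hj, x, hx, h1, h2, h3⟩ := hj
      exact ⟨hj, x, Code.evaln_mono (le_max_left _ _) hx, h1, h2,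
        h3.trans (h.mono _ (le_max_left _ _))⟩
    · intro j hj
      obtain ⟨n, hn, rfl⟩ := Finset.mem_image.1 hj
      rw [Finset.mem_Ico] at hn
      obtain ⟨h1, h2⟩ := hτ n T (hT n hn.2)
      rw [Finset.mem_filter, hitsBlock_iff, Finset.mem_range]
      refine ⟨(hk n hn.1 hn.2).1, A n, h2 hn.1 hn.2, ?_⟩
      rw [hlen, h1]
      exact ⟨hn.1, hn.2, le_rfl⟩
  -- A program of `A n` counted at stage `s` would give `A n ≤ a n s`, hence equality, although the
  -- error at `2 ^ i` persists at `n`.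
  · rw [Finset.disjoint_left]
    intro j hj hj'
    obtain ⟨n, hn, rfl⟩ := Finset.mem_image.1 hj'
    rw [Finset.mem_Ico] at hn
    rw [Finset.mem_filter, hitsBlock_iff] at hj
    obtain ⟨-, x, hx, -, -, h3⟩ := hj
    rw [Part.mem_unique (Code.evaln_sound hx) (hk n hn.1 hn.2).2, hlen] at h3
    exact h.ne_of_ne _ _ _ hn.1 hs (le_antisymm (h.le n s) h3)

/-- If all initial segments whose lengths are in a block `[2 ^ i, 2 ^ (i + 1))` have programs below
`2 ^ (i + e)`, then the sequence is computable. -/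
theorem computable_of_short_programs {c : Code} {A : ℕ → ℕ} {a : ℕ → ℕ → ℕ}
    (h : DigitApprox A a) (ha : Computable₂ a) (hlen : ∀ n, (natToStr (A n)).length = n)
    {e i₁ : ℕ} (hC : ∀ i ≥ i₁, ∀ n, 2 ^ i ≤ n → n < 2 ^ (i + 1) →
      ∃ k < 2 ^ (i + e), A n ∈ c.eval k) :
    Computable A := by
  classical
  -- `Q` fails at `2 ^ e + 1` by `hitCount_le`, so there is a last `r` with `Q r`. It is fixed
  -- non-effectively, as is the bound `i₂` beyond which `r + 1` is never reached.
  let Q : ℕ → Prop := fun r => ∀ j, ∃ i ≥ j, ∃ s, r * 2 ^ i ≤ hitCount c a e i s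
  have hQ0 : Q 0 := fun j => ⟨j, le_rfl, 0, by simp⟩
  obtain ⟨r, hr, hr'⟩ : ∃ r, Q r ∧ ¬ Q (r + 1) := by
    by_contra! hcon
    have hall : ∀ r, Q r := fun r => by
      induction r with
      | zero => exact hQ0
      | succ r ih => exact hcon r ih
    obtain ⟨i, -, s, hs⟩ := hall (2 ^ e + 1) 0
    have := hs.trans (hitCount_le c a e i s)
    have : 0 < 2 ^ i := by positivity
    nlinarith
  simp only [Q] at hr'
  push Not at hr'
  obtain ⟨i₂, hi₂⟩ := hr'
  let p : ℕ → ℕ → Bool := fun n m =>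
    decide (max (max i₁ i₂) n ≤ m.unpair.1) &&
      decide (r * 2 ^ m.unpair.1 ≤ hitCount c a e m.unpair.1 m.unpair.2)
  have hp : Computable₂ p := by
    have h1 : Computable fun x : ℕ × ℕ => x.2.unpair.1 :=
      Computable.fst.comp (Computable.unpair.comp Computable.snd)
    have h2 : Computable fun x : ℕ × ℕ => x.2.unpair.2 :=
      Computable.snd.comp (Computable.unpair.comp Computable.snd)
    refine Primrec.and.to_comp.comp ?_ ?_
    · exact Primrec.nat_le.decide.to_comp.comp
        (Primrec.nat_max.to_comp.comp (Computable.const _) Computable.fst) h1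
    · exact Primrec.nat_le.decide.to_comp.comp
        (Primrec.nat_mul.to_comp.comp (Computable.const r)
          (primrec_pow.to_comp.comp (Computable.const 2) h1))
        ((computable_hitCount c ha e).comp h1 h2)
  have hfind : Partrec fun n => (Nat.rfind (p n : ℕ →. Bool)).map fun m => a n m.unpair.2 :=
    (Partrec.rfind hp.partrec₂).map (ha.comp Computable.fst
      (Computable.snd.comp (Computable.unpair.comp Computable.snd)))
  refine hfind.of_eq_tot fun n => ?_
  obtain ⟨i, hi, s, hs⟩ := hr (max (max i₁ i₂) n)
  obtain ⟨m, hm, -⟩ := Nat.rfind_min' (p := p n) (m := Nat.pair i s) 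
    (by simpa [p, hs] using hi)
  refine (Part.mem_map_iff _).2 ⟨m, hm, ?_⟩
  have hpm : p n m = true := (Part.mem_some_iff.1 (Nat.rfind_spec hm)).symm
  simp only [p, Bool.and_eq_true, decide_eq_true_eq, max_le_iff] at hpm
  obtain ⟨⟨⟨h1, h2⟩, h3⟩, h4⟩ := hpm
  -- An error at `n ≤ 2 ^ i` is an error at `2 ^ i`, and would add `2 ^ i` hits to the `r * 2 ^ i`
  -- already found.
  by_contra hne
  have hne' : a (2 ^ m.unpair.1) m.unpair.2 ≠ A (2 ^ m.unpair.1) :=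
    h.ne_of_ne _ _ _ (h3.trans Nat.lt_two_pow_self.le) hne
  obtain ⟨t, ht⟩ := exists_hitCount_ge h hlen (hC _ h1) hne'
  have := hi₂ _ h2 t
  rw [add_mul] at this
  omega

/-! ### Shortest programs and the machine that uses a running time as a stage. -/

section Complexity

variable {U : Machine}

theorem complexity_le {x p : List Bool} (h : x ∈ U [] p) : complexity U x ≤ p.length :=
  Nat.sInf_le ⟨p, rfl, h⟩

theorem IsUniversalOptimal.exists_complexity_le (hU : IsUniversalOptimal U) {V : Machine}
    (hV : Partrec₂ V) : ∃ c, ∀ x p, x ∈ V [] p → complexity U x ≤ p.length + c := by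
  obtain ⟨c, hc⟩ := hU.optimal V hV
  refine ⟨c, fun x p h => ?_⟩
  obtain ⟨q, hq, hqp⟩ := hc x [] p h
  exact (complexity_le hq).trans hqp

theorem partrec₂_echo : Partrec₂ (fun _ p => Part.some p : Machine) := Computable.snd.partrec

theorem IsUniversalOptimal.exists_shortest (hU : IsUniversalOptimal U) (x : List Bool) :
    ∃ p, p.length = complexity U x ∧ x ∈ U [] p := by
  obtain ⟨c, hc⟩ := hU.optimal _ partrec₂_echo
  obtain ⟨q, hq, -⟩ := hc x [] x (Part.mem_some x)
  exact Nat.sInf_mem (s := {l | ∃ p : List Bool, p.length = l ∧ x ∈ U [] p}) ⟨_, q, rfl, hq⟩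

/-- The machine on the empty input, as a partial function of numbers. -/
def numMachine (U : Machine) : ℕ →. ℕ := fun k => (U [] (natToStr k)).map strToNat

theorem mem_numMachine {k m : ℕ} : m ∈ numMachine U k ↔ natToStr m ∈ U [] (natToStr k) := by
  rw [numMachine, Part.mem_map_iff]
  constructor
  · rintro ⟨x, hx, rfl⟩
    rwa [natToStr_strToNat]
  · exact fun h => ⟨_, h, strToNat_natToStr m⟩

/-- A code supplies the step-bounded `Code.evaln`, the clock against which the enumeration is
compared. -/
theorem IsUniversalOptimal.exists_code (hU : IsUniversalOptimal U) :
    ∃ c : Code, c.eval = numMachine U := by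
  refine Code.exists_code.1 (Partrec.nat_iff.1 ?_)
  exact (hU.partrec.comp (Computable.const []) computable_natToStr).map
    (primrec_strToNat.to_comp.comp Computable.snd)

/-- The self-delimiting pair of a program of an enumeration and of a program of a number. -/
def pairPrograms (P p : List Bool) : List Bool :=
  List.replicate P.length true ++ false :: (P ++ p)

theorem length_pairPrograms (P p : List Bool) :
    (pairPrograms P p).length = p.length + (2 * P.length + 1) := by
  simp [pairPrograms]; ring

/-- The length of the first part of a self-delimiting pair. -/
def splitPoint (w : List Bool) : ℕ := w.findIdx fun b => !b

theorem splitPoint_pairPrograms (P p : List Bool) :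
    splitPoint (pairPrograms P p) = P.length := by
  unfold splitPoint pairPrograms
  generalize P.length = l
  induction l with
  | zero => simp [List.findIdx_cons]
  | succ l ih => rw [List.replicate_succ, List.cons_append, List.findIdx_cons, ih]; simp

def firstProgram (w : List Bool) : List Bool := (w.drop (splitPoint w + 1)).take (splitPoint w)

def secondProgram (w : List Bool) : List Bool := w.drop (splitPoint w + 1 + splitPoint w)

theorem drop_pairPrograms (P p : List Bool) :
    (pairPrograms P p).drop (P.length + 1) = P ++ p := by
  rw [pairPrograms, List.drop_append]; simp

theorem firstProgram_pairPrograms (P p : List Bool) : firstProgram (pairPrograms P p) = P := by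
  rw [firstProgram, splitPoint_pairPrograms, drop_pairPrograms, List.take_left]

theorem secondProgram_pairPrograms (P p : List Bool) : secondProgram (pairPrograms P p) = p := by
  rw [secondProgram, splitPoint_pairPrograms, ← List.drop_drop, drop_pairPrograms, List.drop_left]

theorem primrec_splitPoint : Primrec splitPoint :=
  Primrec.list_findIdx Primrec.id (Primrec.not.comp Primrec.snd)

theorem primrec_firstProgram : Primrec firstProgram :=
  Primrec.list_take.comp primrec_splitPoint
    (Primrec.list_drop.comp (Primrec.succ.comp primrec_splitPoint) Primrec.id)

theorem primrec_secondProgram : Primrec secondProgram :=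
  Primrec.list_drop.comp
    (Primrec.nat_add.comp (Primrec.succ.comp primrec_splitPoint) primrec_splitPoint) Primrec.id

/-- The machine that, given an enumeration `P` of rationals and a program `p` of a number `n`, runs
`p` and prints the first `n` digits of the term of the enumeration whose index is the time that `p`
took. -/
def digitMachine (U : Machine) (c : Code) : Machine := fun _ w =>
  (Nat.rfind fun s => Part.some (Code.evaln s c (strToNat (secondProgram w))).isSome).bind fun s =>
    (c.eval (strToNat (secondProgram w))).bind fun n =>
      (U (natToStr s) (firstProgram w)).map fun r => natToStr (ratDigits n (strToNat r))

theorem partrec₂_digitMachine (hU : Partrec₂ U) (c : Code) : Partrec₂ (digitMachine U c) := by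
  have hp : Computable fun w : List Bool => strToNat (secondProgram w) :=
    (primrec_strToNat.comp primrec_secondProgram).to_comp
  refine Partrec.bind (Partrec.rfind ?_) (Partrec.bind ?_ (Partrec.map ?_ ?_))
  · exact Computable.partrec (Primrec.option_isSome.to_comp.comp
      ((computable_evaln c).comp Computable.snd (hp.comp (Computable.snd.comp Computable.fst))))
  · exact (Partrec.nat_iff.2 (Code.exists_code.2 ⟨c, rfl⟩)).comp
      (hp.comp (Computable.snd.comp Computable.fst))
  · exact hU.comp (computable_natToStr.comp (Computable.snd.comp Computable.fst))
      (primrec_firstProgram.to_comp.comp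
        (Computable.snd.comp (Computable.fst.comp Computable.fst)))
  · exact computable_natToStr.comp (primrec_ratDigits.to_comp.comp
      (Computable.snd.comp Computable.fst) (primrec_strToNat.to_comp.comp Computable.snd))

/-- If the program `p` of `n` takes at least as long as an enumeration takes to get the first `n`
digits right, then these digits have a short description. -/
theorem mem_digitMachine {c : Code} {P p : List Bool} {n t v : ℕ} {q : ℕ → ℕ}
    (hq : ∀ s, natToStr (q s) ∈ U (natToStr s) P) (hv : ∀ s, t ≤ s → ratDigits n (q s) = v)
    (hn : n ∈ c.eval (strToNat p)) (ht : n ∉ Code.evaln t c (strToNat p)) (y : List Bool) :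
    natToStr v ∈ digitMachine U c y (pairPrograms P p) := by
  obtain ⟨k, hk⟩ := Code.evaln_complete.1 hn
  obtain ⟨s, hs, -⟩ := Nat.rfind_min'
    (p := fun s => (Code.evaln s c (strToNat p)).isSome) (m := k) (Option.isSome_of_mem hk)
  have hs' : (Code.evaln s c (strToNat p)).isSome = true :=
    (Part.mem_some_iff.1 (Nat.rfind_spec hs)).symm
  obtain ⟨m, hm⟩ := Option.isSome_iff_exists.1 hs'
  obtain rfl := Part.mem_unique hn (Code.evaln_sound hm)
  -- The halting time `s` cannot precede `t`, since `Code.evaln` is monotone in the step bound.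
  have hts : t ≤ s := by
    by_contra! h
    exact ht (Code.evaln_mono h.le hm)
  unfold digitMachine
  rw [secondProgram_pairPrograms, firstProgram_pairPrograms]
  refine Part.mem_bind hs (Part.mem_bind hn ((Part.mem_map_iff _).2 ⟨_, hq s, ?_⟩))
  rw [strToNat_natToStr, hv s hts]

end Complexity

/-! ### Complexity from a stage with correct digits. -/

/-- The upper bound for the complexity of `n` at the first stage from `s₀` on at which the first
`n` digits of the approximation `q` are those of the string with number `v`. -/
def stagewiseComplexity (c : Code) (q : ℕ → ℕ) (s₀ n v : ℕ) : Part ℕ :=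
  (Nat.rfind fun s => Part.some (decide (ratDigits n (q (s + s₀)) = v))).bind fun s =>
    (Nat.rfind fun k => Part.some (decide (Code.evaln (s + s₀) c k = some n))).map fun k =>
      (natToStr k).length

theorem partrec₂_stagewiseComplexity (c : Code) {q : ℕ → ℕ} (hq : Computable q) (s₀ : ℕ) :
    Partrec₂ (stagewiseComplexity c q s₀) := by
  refine Partrec.bind (Partrec.rfind (Computable.partrec ?_))
    (Partrec.map (Partrec.rfind (Computable.partrec ?_)) ?_)
  · exact Primrec.eq.decide.to_comp.comp
      (primrec_ratDigits.to_comp.comp (Computable.fst.comp Computable.fst)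
        (hq.comp (Primrec.nat_add.to_comp.comp Computable.snd (Computable.const s₀))))
      (Computable.snd.comp Computable.fst)
  · exact Primrec.eq.decide.to_comp.comp
      ((computable_evaln c).comp (Primrec.nat_add.to_comp.comp
        (Computable.snd.comp Computable.fst) (Computable.const s₀)) Computable.snd)
      (Computable.option_some.comp
        (Computable.fst.comp (Computable.fst.comp Computable.fst)))
  · exact Computable.list_length.comp (computable_natToStr.comp Computable.snd)

theorem mem_rfind_some_decide {p : ℕ → Prop} [DecidablePred p] {m : ℕ} (h : p m) :
    ∃ k ∈ Nat.rfind fun s => Part.some (decide (p s)), k ≤ m ∧ p k := by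
  obtain ⟨k, hk, hkm⟩ := Nat.rfind_min' (p := fun s => decide (p s)) (m := m) (by simpa using h)
  refine ⟨k, hk, hkm, ?_⟩
  simpa using (Part.mem_some_iff.1 (Nat.rfind_spec hk)).symm

/-- Any program found bounds `C(n)` from above. The least one is numbered at most as high as the
shortest program `p`, which has halted by `hfast`, and the numbering is monotone in length. -/
theorem natComplexity_mem_stagewiseComplexity {U : Machine} {c : Code}
    (hc : c.eval = numMachine U) {q : ℕ → ℕ} {s₀ n v t : ℕ} {p : List Bool}
    (hp : p.length = natComplexity U n) (ht : ratDigits n (q (t + s₀)) = v)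
    (hfast : ∀ s, ratDigits n (q (s + s₀)) = v → n ∈ Code.evaln (s + s₀) c (strToNat p)) :
    natComplexity U n ∈ stagewiseComplexity c q s₀ n v := by
  obtain ⟨s, hs, -, hsv⟩ := mem_rfind_some_decide (p := fun s => ratDigits n (q (s + s₀)) = v) ht
  obtain ⟨k, hk, hkp, hkn⟩ := mem_rfind_some_decide
    (p := fun k => Code.evaln (s + s₀) c k = some n) (hfast s hsv)
  refine Part.mem_bind hs ((Part.mem_map_iff _).2 ⟨k, hk, le_antisymm ?_ ?_⟩)
  · rw [← hp, ← natToStr_strToNat p]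
    exact length_natToStr_mono hkp
  · have : n ∈ numMachine U k := hc ▸ Code.evaln_sound (Option.mem_def.2 hkn)
    exact complexity_le (mem_numMachine.1 this)

theorem IsUniversalOptimal.exists_enumerates {U : Machine} (hU : IsUniversalOptimal U) {α : ℝ}
    (hα : IsLeftCE α) : ∃ P, Enumerates U P α := by
  obtain ⟨q, hq, hmono, hlim⟩ := hα
  have hf : Computable fun y : List Bool => natToStr (q (strToNat y)) :=
    computable_natToStr.comp (hq.comp primrec_strToNat.to_comp)
  obtain ⟨P, hP⟩ := hU.universal _ hf.partrec
  refine ⟨P, q, fun s => ?_, hmono, hlim⟩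
  rw [hP]
  simp [strToNat_natToStr]

/-- A sequence whose initial segments are as simple as their lengths, up to a constant, is
computable, if it has a computable approximation from the left. -/
theorem IsUniversalOptimal.computable_of_complexity_le {U : Machine} (hU : IsUniversalOptimal U)
    {α : ℝ} {a : ℕ → ℕ → ℕ} (ha : Computable₂ a)
    (h : DigitApprox (fun n => strToNat (initSeg α n)) a) {d N : ℕ}
    (hd : ∀ n, N ≤ n → complexity U (initSeg α n) ≤ natComplexity U n + d) :
    Computable (binDigit α) := by
  obtain ⟨c, hc⟩ := hU.exists_code
  obtain ⟨b, hb⟩ := hU.exists_complexity_le partrec₂_echo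
  -- For `n < 2 ^ (i + 1)` the string of `n` has length at most `i + 1`, so `C(α_n) ≤ i + 1 + b +
  -- d`; programs of length `l` have numbers below `2 ^ (l + 1)`.
  refine computable_binDigit_of_initSeg (computable_of_short_programs (c := c) (e := b + d + 2)
    (i₁ := N) h ha (fun n => by rw [natToStr_strToNat, length_initSeg]) fun i hi n h1 h2 => ?_)
  obtain ⟨p, hp, hpx⟩ := hU.exists_shortest (initSeg α n)
  refine ⟨strToNat p, ?_, ?_⟩
  · have hn : (natToStr n).length ≤ i + 1 := by
      have := pow_length_le_strToNat (natToStr n)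
      rw [strToNat_natToStr] at this
      exact (Nat.pow_le_pow_iff_right (by norm_num : 1 < 2)).1 (this.trans h2)
    have h3 := hd n (hi.trans (Nat.lt_two_pow_self.le.trans h1))
    have h4 : natComplexity U n ≤ (natToStr n).length + b := hb _ _ (Part.mem_some _)
    have h5 := strToNat_lt_pow_length p
    have h6 : 2 ^ (p.length + 1) ≤ 2 ^ (i + (b + d + 2)) :=
      Nat.pow_le_pow_right (by norm_num) (by omega)
    omega
  · rw [hc, mem_numMachine, natToStr_strToNat, natToStr_strToNat]
    exact hpx

theorem mainTheorem10 (U : Machine) (hU : IsUniversalOptimal U) :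
    ∃ D : ℕ → ℕ, Computable D ∧
      ∀ α : ℝ, IsLeftCE α → ¬ Computable (binDigit α) →
        (∃ P : List Bool, Enumerates U P α) ∧
        ∀ P : List Bool, Enumerates U P α →
          ∃ Cstar : ℕ →. ℕ, TuringReducible Cstar (digitOracle α) ∧
            (∀ n : ℕ, complexity U (initSeg α n) > natComplexity U n + D P.length →
              natComplexity U n ∈ Cstar n) ∧
            {n : ℕ | complexity U (initSeg α n) > natComplexity U n + D P.length}.Infinite ∧
            {n : ℕ | natComplexity U n ∈ Cstar n}.Infinite := by
  obtain ⟨c, hc⟩ := hU.exists_code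
  obtain ⟨b, hb⟩ := hU.exists_complexity_le (partrec₂_digitMachine hU.partrec c)
  -- The overhead `2 * l + 1` of the self-delimiting pair, plus the cost `b` of simulating
  -- `digitMachine`.
  refine ⟨fun l => 2 * l + 1 + b, (Primrec.nat_add.comp Primrec.nat_double_succ
    (Primrec.const b)).to_comp, fun α hα hαc => ⟨hU.exists_enumerates hα, ?_⟩⟩
  rintro P ⟨q, hqP, hmono, hlim⟩
  have hq : Computable q := by
    have : Partrec fun s => (U (natToStr s) P).map strToNat :=
      (hU.partrec.comp computable_natToStr (Computable.const P)).map
        (primrec_strToNat.to_comp.comp Computable.snd)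
    exact this.of_eq_tot fun s => (Part.mem_map_iff _).2 ⟨_, hqP s, strToNat_natToStr _⟩
  obtain ⟨s₀, hs₀⟩ := exists_digitApprox hmono hlim hαc
  have hC : ∀ n, complexity U (initSeg α n) > natComplexity U n + (2 * P.length + 1 + b) →
      natComplexity U n ∈ stagewiseComplexity c q s₀ n (strToNat (initSeg α n)) := by
    intro n hn
    obtain ⟨p, hp, hpn⟩ := hU.exists_shortest (natToStr n)
    obtain ⟨t, ht⟩ := hs₀.eventually_eq n
    refine natComplexity_mem_stagewiseComplexity hc hp ht fun s hs => ?_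
    by_contra hslow
    have hmem := mem_digitMachine (c := c) (v := strToNat (initSeg α n)) hqP (fun s' hs' => ?_)
      (by rwa [hc, mem_numMachine, natToStr_strToNat]) hslow []
    · rw [natToStr_strToNat] at hmem
      have := hb _ _ hmem
      rw [length_pairPrograms, hp] at this
      exact absurd hn (not_lt.2 (by simpa [natComplexity, add_assoc] using this))
    -- `digitMachine` uses the unshifted enumeration. The step bound in `stagewiseComplexity` is `s
    -- + s₀`, so a slow program halts at some `s' ≥ s + s₀`, where the digits are still right.
    · have := hs₀.eq_of_le (show s ≤ s' - s₀ by omega) hs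
      rwa [Nat.sub_add_cancel (by omega)] at this
  have hinf : {n : ℕ | complexity U (initSeg α n) >
      natComplexity U n + (2 * P.length + 1 + b)}.Infinite := by
    intro hfin
    obtain ⟨N, hN⟩ := hfin.bddAbove
    refine hαc (hU.computable_of_complexity_le (N := N + 1) (d := 2 * P.length + 1 + b) ?_ hs₀
      fun n hn => ?_)
    · exact primrec_ratDigits.to_comp.comp Computable.fst
        (hq.comp (Primrec.nat_add.to_comp.comp Computable.snd (Computable.const s₀)))
    · by_contra! h
      have := hN h
      omega
  exact ⟨fun n => stagewiseComplexity c q s₀ n (strToNat (initSeg α n)),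
    recursiveIn_of_initial_segment (fun _ => rfl) (partrec₂_stagewiseComplexity c hq s₀), hC, hinf,
    hinf.mono hC⟩
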